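/- Let $\mathbb K$ be a field, $R=\mathbb K[x_1,\ldots,x_k]$, and let $\mathcal A=\{\ell_1,\ldots,\ell_n\}\subset R$ be the defining linear forms of a central hyperplane arrangement of size $n$ and rank $k$; that is, the $\ell_i$ are nonzero, pairwise non-proportional linear forms with $\langle \ell_1,\ldots,\ell_n\rangle=\langle x_1,\ldots,x_k\rangle$. For $1\le j\le n$ put $f_j:=\prod_{i\neq j}\ell_i$ and let $I=\langle f_1,\ldots,f_n\rangle\subset R$ be the ideal of $(n-1)$-fold products. Let $T=R[y_1,\ldots,y_n]$, let $\mathcal I(\mathcal A,n-1)\subset T$ be the presentation ideal of the Rees algebra of $I$, i.e. the kernel of the $R$-algebra homomorphism $T\to R[It]$, $y_j\mapsto f_jt$, and let $\mathcal I_1(\mathcal A,n-1)\subset T$ be the presentation ideal of the symmetric algebra of $I$, i.e. the ideal generated by the elements of $\mathcal I(\mathcal A,n-1)$ that are homogeneous of degree one in $y_1,\ldots,y_n$ (equivalently, by the forms $s_1y_1+\cdots+s_ny_n$ with $s_j\in R$ and $s_1f_1+\cdots+s_nf_n=0$). Then, for every $i\in\{1,\ldots,n\}$, $$\mathcal I(\mathcal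 A,n-1)=\mathcal I_1(\mathcal A,n-1):\ell_iy_i .$$ -/

import Mathlib

namespace ReesArrangement

open MvPolynomial

section Blowup

variable {R : Type*} [CommRing R] {n : ℕ}

/-- The surjective homomorphism of `R`-algebras `φ : R[y₁, …, yₙ] → R[It]`, `yⱼ ↦ gⱼ t`, where
`I = ⟨g₁, …, gₙ⟩` and the Rees algebra `R[It]` is regarded as a subalgebra of `R[t]`. -/
noncomputable def reesMap (g : Fin n → R) :
    MvPolynomial (Fin n) R →ₐ[R] reesAlgebra (Ideal.span (Set.range g)) :=
  aeval fun j => ⟨Polynomial.monomial 1 (g j),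
    reesAlgebra.monomial_mem.2 (by
      rw [pow_one]
      exact Ideal.subset_span ⟨j, rfl⟩)⟩

/-- The presentation ideal of the Rees algebra of `⟨g₁, …, gₙ⟩` in `R[y₁, …, yₙ]` with respect to
the generators `g₁, …, gₙ`. -/
noncomputable def reesIdeal (g : Fin n → R) : Ideal (MvPolynomial (Fin n) R) :=
  RingHom.ker (reesMap g)

/-- The presentation ideal of the symmetric algebra of `⟨g₁, …, gₙ⟩`: the ideal of `R[y₁, …, yₙ]`
generated by the elements of the Rees ideal that are homogeneous of degree one in the variables
`y₁, …, yₙ`, that is, by the forms `s₁ y₁ + ⋯ + sₙ yₙ` with `s₁ g₁ + ⋯ + sₙ gₙ = 0`. -/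
noncomputable def symIdeal (g : Fin n → R) : Ideal (MvPolynomial (Fin n) R) :=
  Ideal.span {F | F ∈ reesIdeal g ∧ F.IsHomogeneous 1}

end Blowup

section Arrangement

variable {K : Type*} [Field K] {k n : ℕ}

/-- The polynomials `ℓ₁, …, ℓₙ ∈ K[x₁, …, xₖ]` are the defining linear forms of a central
arrangement of `n` distinct hyperplanes, of rank `k`. -/
structure IsCentralArrangement (ℓ : Fin n → MvPolynomial (Fin k) K) : Prop where
  isLinearForm : ∀ i, (ℓ i).IsHomogeneous 1
  ne_zero : ∀ i, ℓ i ≠ 0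
  not_proportional : ∀ i j, i ≠ j → ∀ c : K, ℓ i ≠ c • ℓ j
  span_eq : Ideal.span (Set.range ℓ) =
    Ideal.span (Set.range (X : Fin k → MvPolynomial (Fin k) K))

/-- The `(n-1)`-fold product `fⱼ` of all the forms except `ℓⱼ`. -/
noncomputable def foldProd (ℓ : Fin n → MvPolynomial (Fin k) K) (j : Fin n) :
    MvPolynomial (Fin k) K :=
  ∏ i ∈ Finset.univ.erase j, ℓ i

end Arrangement

end ReesArrangement

/-!
Write `p` for the product of the forms `ℓⱼ` and `fⱼ = p / ℓⱼ` for the products of all forms but one.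
The colon ideal lies in the Rees ideal because the latter is prime, contains the symmetric ideal and
does not contain `ℓᵢ yᵢ`. The content is the other inclusion: `ℓᵢ yᵢ` multiplies the Rees ideal into
the symmetric ideal.

The elements `ℓⱼ yⱼ - ℓᵢ yᵢ` belong to the symmetric ideal, so it suffices to work over `R[z]`,
modulo the ideal `J` of `R[z][y₁, …, yₙ]` generated by the `ℓⱼ yⱼ - z`, and to prove `z F ∈ J` for
`F` in the Rees ideal (`mul_X_mul_mem_symIdeal`). One may take `F` homogeneous of degree `e` in the
`yⱼ`. Modulo `J` one has `p yⱼ = z fⱼ`, hence `p ^ e F = z ^ e F(f₁, …, fₙ) = 0`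
(`pow_prod_mul_mem_incidenceIdeal`). It remains to cancel `p ^ e` on the multiples of `z`.

This cancellation is `regularOnMultiples_incidenceIdeal`: if `P` is an ideal such that `P` together
with any of the `ℓⱼ` generates a prime ideal, then every element of the base ring outside `P` is a
nonzerodivisor on the multiples of `z` modulo `P` and the `ℓⱼ yⱼ - z`. The proof adjoins one
variable `y` with `ℓ y = z` at a time (`RegularOnMultiples.adjoin`). If `F` is a torsion element
with leading term `a y ^ m`, then substituting `z / ℓ` for `y` shows that `z ^ (m + 1) a` is a
multiple of `ℓ`. By the induction hypothesis for `P + (ℓ)` so is `z a = ℓ E`, and `ℓ y = z` gives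
`z a y ^ m = z E y ^ (m - 1)`, which lowers the degree. When `P + (ℓ)` contains one of the earlier
forms, `z` vanishes modulo that ideal, so this case needs no separate treatment.

The primality hypothesis holds because any set of linear forms generates a prime ideal
(`isPrime_span_of_isHomogeneous_one`).
-/

namespace ReesArrangement

open MvPolynomial

/-! ### Elements regular on the multiples of a fixed element -/

/-- The element `q` is a nonzerodivisor on the ideal generated by `z` in the quotient `B ⧸ J`. -/
def RegularOnMultiples {B : Type*} [CommRing B] (J : Ideal B) (z q : B) : Prop :=
  ∀ f, q * (z * f) ∈ J → z * f ∈ J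

namespace RegularOnMultiples

variable {B : Type*} [CommRing B] {J : Ideal B} {z q : B}

theorem pow (h : RegularOnMultiples J z q) (m : ℕ) : RegularOnMultiples J z (q ^ m) := by
  induction m with
  | zero => intro f hf; simpa using hf
  | succ m ih =>
    intro f hf
    have h' : q * (z * (q ^ m * f)) ∈ J := by convert hf using 1; ring
    exact ih f (by convert h _ h' using 1; ring)

theorem of_mem (hz : z ∈ J) : RegularOnMultiples J z q :=
  fun f _ => J.mul_mem_right f hz

theorem of_isPrime (hJ : J.IsPrime) (hq : q ∉ J) : RegularOnMultiples J z q :=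
  fun _ hf => (hJ.mem_or_mem hf).resolve_left hq

theorem of_ringEquiv {A : Type*} [CommRing A] (e : B ≃+* A)
    (h : RegularOnMultiples (J.map (e : B →+* A)) (e z) (e q)) : RegularOnMultiples J z q := by
  have key : ∀ f, f ∈ J ↔ e f ∈ J.map (e : B →+* A) := fun f => by
    refine ⟨fun hf => Ideal.mem_map_of_mem (e : B →+* A) hf, fun hf => ?_⟩
    obtain ⟨g, hg, hgf⟩ := (Ideal.mem_map_iff_of_surjective (e : B →+* A) e.surjective).1 hf
    rwa [← e.injective hgf]
  intro f hf
  rw [key] at hf ⊢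
  simpa using h (e f) (by simpa using hf)

end RegularOnMultiples

/-! ### Adjoining one variable -/

section OneVariable

open Polynomial (natDegree)

variable {B : Type*} [CommRing B]

/-- Modulo `r * X - z`, a polynomial of degree at most `m` becomes constant after multiplication
by `r ^ m`, and only the leading coefficient contributes a term that `r` need not divide. -/
theorem exists_pow_mul_sub_C_mem (z r : B) (m : ℕ) (F : Polynomial B) (hF : F.natDegree ≤ m) :
    ∃ e : B, Polynomial.C (r ^ m) * F - Polynomial.C (z ^ m * F.coeff m + r * e) ∈
      Ideal.span {Polynomial.C r * Polynomial.X - Polynomial.C z} := by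
  induction m generalizing F with
  | zero =>
    refine ⟨0, ?_⟩
    rw [Polynomial.eq_C_of_natDegree_le_zero hF]
    simp
  | succ m ih =>
    set G := F - Polynomial.C (F.coeff (m + 1)) * Polynomial.X ^ (m + 1) with hG
    have hGdeg : G.natDegree ≤ m := by
      refine Polynomial.natDegree_le_iff_coeff_eq_zero.2 fun N hN => ?_
      rcases Nat.lt_or_ge (m + 1) N with h | h
      · simp [hG, Polynomial.coeff_X_pow, h.ne', Polynomial.coeff_eq_zero_of_natDegree_lt
          (lt_of_le_of_lt hF h)]
      · obtain rfl : N = m + 1 := le_antisymm h hN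
        simp [hG]
    obtain ⟨e, he⟩ := ih G hGdeg
    refine ⟨z ^ m * G.coeff m + r * e, ?_⟩
    have hdvd : Polynomial.C r * Polynomial.X - Polynomial.C z ∣
        (Polynomial.C r * Polynomial.X) ^ (m + 1) - Polynomial.C z ^ (m + 1) :=
      sub_dvd_pow_sub_pow _ _ _
    have h2 := Ideal.mul_mem_left _ (Polynomial.C (F.coeff (m + 1)))
      (Ideal.mem_span_singleton.2 hdvd)
    convert add_mem (Ideal.mul_mem_left _ (Polynomial.C r) he) h2 using 1
    have hFG : F = G + Polynomial.C (F.coeff (m + 1)) * Polynomial.X ^ (m + 1) := by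
      rw [hG]; ring
    generalize F.coeff (m + 1) = a at hFG ⊢
    generalize G.coeff m = b
    rw [hFG]
    simp only [map_add, map_mul, map_pow]
    ring

/-- A constant that vanishes after adjoining a root of `r * X - z` is killed by a power of `r`:
such a root exists once `r` is inverted. -/
theorem exists_pow_mul_mem_of_C_mem (J : Ideal B) (z r c : B)
    (hc : Polynomial.C c ∈
      J.map Polynomial.C ⊔ Ideal.span {Polynomial.C r * Polynomial.X - Polynomial.C z}) :
    ∃ m : ℕ, r ^ m * c ∈ J := by
  let L := Localization.Away (Ideal.Quotient.mk J r)
  let φ : B →+* L := (algebraMap (B ⧸ J) L).comp (Ideal.Quotient.mk J)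
  let y : L := φ z * IsLocalization.Away.invSelf (S := L) (Ideal.Quotient.mk J r)
  have hr : φ r * IsLocalization.Away.invSelf (S := L) (Ideal.Quotient.mk J r) = 1 :=
    IsLocalization.Away.mul_invSelf (S := L) (Ideal.Quotient.mk J r)
  have hle : J.map Polynomial.C ⊔ Ideal.span {Polynomial.C r * Polynomial.X - Polynomial.C z} ≤
      RingHom.ker (Polynomial.eval₂RingHom φ y) := by
    refine sup_le (Ideal.map_le_iff_le_comap.2 fun b hb => ?_) ?_
    · simp [RingHom.mem_ker, φ, Ideal.Quotient.eq_zero_iff_mem.2 hb]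
    · rw [Ideal.span_singleton_le_iff_mem, RingHom.mem_ker]
      simp only [map_sub, map_mul, Polynomial.coe_eval₂RingHom, Polynomial.eval₂_C,
        Polynomial.eval₂_X, y]
      linear_combination φ z * hr
  have h0 : algebraMap (B ⧸ J) L (Ideal.Quotient.mk J c) = 0 := by
    simpa [RingHom.mem_ker, φ] using hle hc
  obtain ⟨⟨_, m, rfl⟩, hm⟩ := (IsLocalization.map_eq_zero_iff
    (Submonoid.powers (Ideal.Quotient.mk J r)) L _).1 h0
  exact ⟨m, by rw [← Ideal.Quotient.eq_zero_iff_mem, map_mul, map_pow]; exact hm⟩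

/-- Regularity on the multiples of `z` passes from `B ⧸ J` to `(B ⧸ J)[X] ⧸ (r * X - z)`. The
hypothesis on `J ⊔ (r)` makes the leading coefficient of a torsion element divisible by `r` up to
`z`-torsion, and then `r * X = z` lowers the degree. -/
theorem RegularOnMultiples.adjoin {J : Ideal B} {z r q : B}
    (hr : RegularOnMultiples J z r) (hq : RegularOnMultiples J z q)
    (hzr : RegularOnMultiples (J ⊔ Ideal.span {r}) z z) :
    RegularOnMultiples
      (J.map Polynomial.C ⊔ Ideal.span {Polynomial.C r * Polynomial.X - Polynomial.C z})
      (Polynomial.C z) (Polynomial.C q) := by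
  set Q := J.map Polynomial.C ⊔ Ideal.span {Polynomial.C r * Polynomial.X - Polynomial.C z}
  have hconst : ∀ c, Polynomial.C (q * (z * c)) ∈ Q → z * c ∈ J := fun c hc => by
    obtain ⟨m, hm⟩ := exists_pow_mul_mem_of_C_mem J z r _ hc
    have h : z * (q * c) ∈ J := hr.pow m (q * c) (by convert hm using 1; ring)
    exact hq c (by convert h using 1; ring)
  have main : ∀ m (F : Polynomial B), F.natDegree ≤ m →
      Polynomial.C q * (Polynomial.C z * F) ∈ Q → Polynomial.C z * F ∈ Q := by
    intro m
    induction m with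
    | zero =>
      intro F hF h
      rw [Polynomial.eq_C_of_natDegree_le_zero hF, ← map_mul] at h ⊢
      rw [← map_mul] at h
      exact le_sup_left (a := J.map Polynomial.C) (Ideal.mem_map_of_mem _ (hconst _ h))
    | succ m ih =>
      intro F hF h
      obtain ⟨e, he⟩ := exists_pow_mul_sub_C_mem z r (m + 1) F hF
      set a := F.coeff (m + 1) with ha
      have h1 : z * (z ^ (m + 1) * a + r * e) ∈ J := by
        apply hconst
        have h2 := Ideal.mul_mem_left _ (Polynomial.C (q * z))
          (le_sup_right (a := J.map Polynomial.C) he)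
        convert sub_mem (Q.mul_mem_left (Polynomial.C (r ^ (m + 1))) h) h2 using 1
        simp only [map_add, map_mul, map_pow]
        ring
      have h3 : z * a ∈ J ⊔ Ideal.span {r} := by
        apply hzr.pow (m + 1)
        have h4 : r * (z * e) ∈ J ⊔ Ideal.span {r} :=
          Ideal.mul_mem_right _ _ (le_sup_right (a := J) (Ideal.mem_span_singleton_self r))
        convert sub_mem (le_sup_left (b := Ideal.span {r}) h1) h4 using 1
        ring
      obtain ⟨j, hj, E', hE', hjE⟩ := Submodule.mem_sup.1 h3
      obtain ⟨E, rfl⟩ := Ideal.mem_span_singleton.1 hE'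
      -- Up to `z`-torsion, the leading term `a * X ^ (m + 1)` equals `E * X ^ m`.
      set G := F - (Polynomial.C a * Polynomial.X - Polynomial.C E) * Polynomial.X ^ m with hG
      have hdiff : Polynomial.C z * (F - G) ∈ Q := by
        have h5 : Polynomial.C j ∈ Q :=
          le_sup_left (a := J.map Polynomial.C) (Ideal.mem_map_of_mem _ hj)
        have h6 : Polynomial.C r * Polynomial.X - Polynomial.C z ∈ Q :=
          le_sup_right (a := J.map Polynomial.C) (Ideal.mem_span_singleton_self _)
        convert add_mem (Q.mul_mem_right (Polynomial.X ^ (m + 1)) h5)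
          (Q.mul_mem_right (Polynomial.C E * Polynomial.X ^ m) h6) using 1
        have h7 := congrArg Polynomial.C hjE
        simp only [map_add, map_mul] at h7
        rw [hG]
        linear_combination (-Polynomial.X ^ (m + 1)) * h7
      have hGdeg : G.natDegree ≤ m := by
        refine Polynomial.natDegree_le_iff_coeff_eq_zero.2 fun N hN => ?_
        obtain ⟨N, rfl⟩ : ∃ N', N = N' + 1 := ⟨N - 1, by omega⟩
        have hNm : ¬ N + 1 = m := by omega
        have hG' : G = F - Polynomial.C a * Polynomial.X ^ (m + 1) +
            Polynomial.C E * Polynomial.X ^ m := by rw [hG]; ring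
        rcases Nat.lt_or_ge m N with h | h
        · simp [hG', Polynomial.coeff_X_pow, h.ne', hNm, Polynomial.coeff_eq_zero_of_natDegree_lt
            (lt_of_le_of_lt hF (Nat.succ_lt_succ h))]
        · obtain rfl : N = m := by omega
          simp [hG', ha, Polynomial.coeff_X_pow]
      have hGQ : Polynomial.C z * G ∈ Q := by
        apply ih G hGdeg
        convert sub_mem h (Q.mul_mem_left (Polynomial.C q) hdiff) using 1
        ring
      convert add_mem hdiff hGQ using 1
      ring
  exact fun F => main F.natDegree F le_rfl

end OneVariable

/-! ### Adjoining all the variables -/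

section Incidence

variable {D : Type*} [CommRing D]

/-- The ideal of `D[y₁, …, yₙ]` generated by `P` and the elements `rⱼ yⱼ - z`. -/
noncomputable def incidenceIdeal {n : ℕ} (P : Ideal D) (z : D) (r : Fin n → D) :
    Ideal (MvPolynomial (Fin n) D) :=
  P.map C ⊔ Ideal.span (Set.range fun j => C (r j) * X j - C z)

theorem mul_X_sub_mem_incidenceIdeal {n : ℕ} (P : Ideal D) (z : D) (r : Fin n → D) (j : Fin n) :
    C (r j) * X j - C z ∈ incidenceIdeal P z r :=
  le_sup_right (a := P.map C) (Ideal.subset_span ⟨j, rfl⟩)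

theorem C_mem_incidenceIdeal {n : ℕ} {P : Ideal D} (z : D) (r : Fin n → D) {a : D} (ha : a ∈ P) :
    C a ∈ incidenceIdeal P z r :=
  le_sup_left (a := P.map C) (Ideal.mem_map_of_mem _ ha)

theorem C_mem_incidenceIdeal_of_coeff_mem {n : ℕ} {P : Ideal D} {z : D} {r : Fin n → D}
    {j : Fin n} (hj : r j ∈ P) : C z ∈ incidenceIdeal P z r := by
  convert sub_mem (Ideal.mul_mem_right (X j) _ (C_mem_incidenceIdeal z r hj))
    (mul_X_sub_mem_incidenceIdeal P z r j) using 1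
  ring

theorem incidenceIdeal_sup_span_C {n : ℕ} (P : Ideal D) (z a : D) (r : Fin n → D) :
    incidenceIdeal P z r ⊔ Ideal.span {C a} = incidenceIdeal (P ⊔ Ideal.span {a}) z r := by
  simp only [incidenceIdeal, Ideal.map_sup, Ideal.map_span, Set.image_singleton]
  rw [sup_assoc, sup_assoc, sup_comm (Ideal.span {C a})]

theorem map_finSuccEquiv_incidenceIdeal {n : ℕ} (P : Ideal D) (z : D) (r : Fin (n + 1) → D) :
    (incidenceIdeal P z r).map
        ((finSuccEquiv D n).toRingEquiv :
          MvPolynomial (Fin (n + 1)) D →+* Polynomial (MvPolynomial (Fin n) D)) =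
      (incidenceIdeal P z (Fin.tail r)).map Polynomial.C ⊔
        Ideal.span {Polynomial.C (C (r 0)) * Polynomial.X - Polynomial.C (C z)} := by
  have hC : ((finSuccEquiv D n).toRingEquiv :
      MvPolynomial (Fin (n + 1)) D →+* Polynomial (MvPolynomial (Fin n) D)).comp C =
      Polynomial.C.comp C := by
    ext1 a
    simp [finSuccEquiv_apply]
  simp only [incidenceIdeal, Ideal.map_sup, Ideal.map_map, Ideal.map_span, hC, sup_assoc,
    ← Ideal.span_union]
  congr 2
  ext f
  simp only [Set.mem_image, Set.mem_range, exists_exists_eq_and, Fin.exists_fin_succ, Fin.tail,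
    Set.mem_union, Set.mem_singleton_iff]
  simp [finSuccEquiv_apply, or_comm, eq_comm]

/-- If `P` and all ideals generated by `P` and some of the `rⱼ` are prime, then every element
outside `P` is regular on the multiples of `z` modulo `P` and the `rⱼ yⱼ - z`. -/
theorem regularOnMultiples_incidenceIdeal {n : ℕ} (P : Ideal D) (z : D) (r : Fin n → D)
    (hP : ∀ S : Set (Fin n), (P ⊔ Ideal.span (r '' S)).IsPrime) {q : D} (hq : q ∉ P) :
    RegularOnMultiples (incidenceIdeal P z r) (C z) (C q) := by
  induction n generalizing P q with
  | zero =>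
    have hP' : P.IsPrime := by simpa using hP ∅
    have h : incidenceIdeal P z r = P.map C := by simp [incidenceIdeal]
    rw [h]
    have hC : ∀ a : D, isEmptyRingEquiv D (Fin 0) (C a) = a := fun a => by
      rw [← isEmptyRingEquiv_symm_apply, RingEquiv.apply_symm_apply]
    have hPe : (P.map C).map
        (isEmptyRingEquiv D (Fin 0) : MvPolynomial (Fin 0) D →+* D) = P := by
      rw [Ideal.map_map]
      convert Ideal.map_id P using 2
      ext1 a
      simp [hC]
    refine .of_ringEquiv (isEmptyRingEquiv D (Fin 0)) ?_
    rw [hPe]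
    exact .of_isPrime hP' (by rwa [hC])
  | succ n ih =>
    -- If `r 0 ∈ P`, then `z = r 0 * y₀` vanishes in the quotient and nothing is to be shown.
    by_cases h0 : r 0 ∈ P
    · exact .of_mem (C_mem_incidenceIdeal_of_coeff_mem h0)
    have hP1 : ∀ S : Set (Fin n), (P ⊔ Ideal.span (Fin.tail r '' S)).IsPrime := fun S => by
      have := hP (Fin.succ '' S)
      rwa [Set.image_image] at this
    -- The ideal `P ⊔ (r 0)` may contain other `rⱼ`; the induction hypothesis does not exclude this.
    have hP2 : ∀ S : Set (Fin n),
        (P ⊔ Ideal.span {r 0} ⊔ Ideal.span (Fin.tail r '' S)).IsPrime := fun S => by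
      have := hP (insert 0 (Fin.succ '' S))
      rw [Set.image_insert_eq, Ideal.span_insert, ← sup_assoc, Set.image_image] at this
      exact this
    have hz : RegularOnMultiples (incidenceIdeal (P ⊔ Ideal.span {r 0}) z (Fin.tail r))
        (C z) (C z) := by
      by_cases hz : z ∈ P ⊔ Ideal.span {r 0}
      · exact .of_mem (C_mem_incidenceIdeal _ _ hz)
      · exact ih _ _ hP2 hz
    refine .of_ringEquiv (finSuccEquiv D n).toRingEquiv ?_
    rw [map_finSuccEquiv_incidenceIdeal]
    have h := RegularOnMultiples.adjoin (ih P _ hP1 h0) (ih P _ hP1 hq)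
      (by rw [incidenceIdeal_sup_span_C]; exact hz)
    convert h using 1 <;> simp [finSuccEquiv_apply]

end Incidence

/-! ### Ideals of linear forms -/

/-- Any set of linear forms generates a prime ideal: it is the kernel of the substitution by a
linear projection whose kernel is the span of the forms. -/
theorem isPrime_span_of_isHomogeneous_one {σ K : Type*} [Field K] (S : Set (MvPolynomial σ K))
    (hS : ∀ f ∈ S, f.IsHomogeneous 1) : (Ideal.span S).IsPrime := by
  let W := Submodule.span K S
  obtain ⟨s, hs⟩ := W.mkQ.exists_rightInverse_of_surjective (by simp)
  have hs' : ∀ v, W.mkQ (s v) = v := fun v => LinearMap.congr_fun hs v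
  let π : MvPolynomial σ K →ₗ[K] MvPolynomial σ K := s ∘ₗ W.mkQ
  have hW : ∀ f ∈ W, f ∈ Ideal.span S := fun f hf =>
    Submodule.span_le_restrictScalars K (MvPolynomial σ K) S hf
  have hπ : ∀ f, f - π f ∈ Ideal.span S := fun f => hW _ <| by
    rw [← Submodule.ker_mkQ W, LinearMap.mem_ker, map_sub]
    simp [π, hs', -Submodule.mkQ_apply]
  let φ : MvPolynomial σ K →ₐ[K] MvPolynomial σ K := aeval fun i => π (X i)
  have hφ : ∀ f, f.IsHomogeneous 1 → φ f = π f := fun f hf => by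
    rw [← mem_homogeneousSubmodule, homogeneousSubmodule_one_eq_span_X] at hf
    induction hf using Submodule.span_induction with
    | mem f hf => obtain ⟨i, rfl⟩ := hf; simp [φ]
    | zero => simp
    | add f g _ _ hf hg => simp [hf, hg]
    | smul a f _ hf => simp [hf]
  have hker : Ideal.span S = RingHom.ker φ := by
    refine le_antisymm (Ideal.span_le.2 fun f hf => ?_) fun f hf => ?_
    · have : W.mkQ f = 0 := by
        rw [← LinearMap.mem_ker, Submodule.ker_mkQ]; exact Submodule.subset_span hf
      rw [SetLike.mem_coe, RingHom.mem_ker, hφ f (hS f hf)]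
      simp only [π, LinearMap.comp_apply, this, map_zero]
    · have h : (Ideal.Quotient.mkₐ K (Ideal.span S)).comp φ =
          Ideal.Quotient.mkₐ K (Ideal.span S) := by
        ext i
        simpa [φ, eq_comm] using Ideal.Quotient.eq.2 (hπ (X i))
      have h2 := AlgHom.congr_fun h f
      rw [AlgHom.comp_apply, (RingHom.mem_ker).1 hf, map_zero] at h2
      exact Ideal.Quotient.eq_zero_iff_mem.1 h2.symm
  rw [hker]
  exact RingHom.ker_isPrime _

/-! ### The Rees ideal -/

section Rees

theorem aeval_mul_of_isHomogeneous {σ R A : Type*} [CommRing R] [CommRing A] [Algebra R A]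
    {F : MvPolynomial σ R} {e : ℕ} (hF : F.IsHomogeneous e) (a : A) (v : σ → A) :
    aeval (fun j => a * v j) F = a ^ e * aeval v F := by
  rw [aeval_def, aeval_def, eval₂_eq, eval₂_eq, Finset.mul_sum]
  refine Finset.sum_congr rfl fun d hd => ?_
  have hdeg : ∑ i ∈ d.support, d i = e := by
    have := hF (mem_support_iff.1 hd)
    simpa [Finsupp.weight_apply, Finsupp.sum] using this
  rw [← hdeg, ← Finset.prod_pow_eq_pow_sum]
  simp only [mul_pow, Finset.prod_mul_distrib]
  ring

variable {R : Type*} [CommRing R] {n : ℕ} (g : Fin n → R)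

theorem coe_reesMap (F : MvPolynomial (Fin n) R) :
    (reesMap g F : Polynomial R) = aeval (fun j => Polynomial.X * Polynomial.C (g j)) F := by
  rw [reesMap, ← Subalgebra.coe_val, ← AlgHom.comp_apply, comp_aeval]
  congr 2
  ext1 j
  exact (Polynomial.C_mul_X_eq_monomial (a := g j)).symm.trans (mul_comm _ _)

theorem coe_reesMap_of_isHomogeneous {F : MvPolynomial (Fin n) R} {e : ℕ}
    (hF : F.IsHomogeneous e) :
    (reesMap g F : Polynomial R) = Polynomial.monomial e (aeval g F) := by
  rw [coe_reesMap, aeval_mul_of_isHomogeneous hF, ← Polynomial.C_mul_X_pow_eq_monomial, mul_comm]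
  congr 1
  exact (aeval_algebraMap_apply (Polynomial R) g F)

theorem mem_reesIdeal_iff_of_isHomogeneous {F : MvPolynomial (Fin n) R} {e : ℕ}
    (hF : F.IsHomogeneous e) : F ∈ reesIdeal g ↔ aeval g F = 0 := by
  rw [reesIdeal, RingHom.mem_ker, ← Subtype.coe_inj, coe_reesMap_of_isHomogeneous g hF]
  simp

/-- The Rees ideal is homogeneous in the variables `y₁, …, yₙ`. -/
theorem aeval_homogeneousComponent_eq_zero {F : MvPolynomial (Fin n) R} (hF : F ∈ reesIdeal g)
    (e : ℕ) : aeval g (homogeneousComponent e F) = 0 := by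
  by_cases he : e ∈ Finset.range (F.totalDegree + 1)
  swap
  · rw [homogeneousComponent_eq_zero e F (by simpa using he), map_zero]
  have h : ((reesMap g F : reesAlgebra _) : Polynomial R) = 0 := by
    rw [(RingHom.mem_ker).1 hF]; rfl
  rw [← sum_homogeneousComponent F, map_sum, AddSubmonoidClass.coe_finsetSum] at h
  simp only [coe_reesMap_of_isHomogeneous g (homogeneousComponent_isHomogeneous _ F)] at h
  simpa [Polynomial.finsetSum_coeff, Polynomial.coeff_monomial, Finset.sum_ite_eq', he]
    using congrArg (fun p => Polynomial.coeff p e) h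

instance isPrime_reesIdeal [IsDomain R] : (reesIdeal g).IsPrime :=
  RingHom.ker_isPrime _

theorem symIdeal_le_reesIdeal : symIdeal g ≤ reesIdeal g :=
  Ideal.span_le.2 fun _ hF => hF.1

theorem C_mul_X_mem_reesIdeal_iff (a : R) (i : Fin n) :
    C a * X i ∈ reesIdeal g ↔ a * g i = 0 := by
  rw [mem_reesIdeal_iff_of_isHomogeneous g (by
    simpa using (isHomogeneous_C _ a).mul (isHomogeneous_X R i))]
  simp

theorem sub_mem_symIdeal {a b : R} {i j : Fin n} (h : a * g i = b * g j) :
    C a * X i - C b * X j ∈ symIdeal g := by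
  have hh : (C a * X i - C b * X j : MvPolynomial (Fin n) R).IsHomogeneous 1 := by
    simpa using ((isHomogeneous_C _ a).mul (isHomogeneous_X R i)).sub
      ((isHomogeneous_C _ b).mul (isHomogeneous_X R j))
  refine Ideal.subset_span ⟨(mem_reesIdeal_iff_of_isHomogeneous g hh).2 ?_, hh⟩
  simp [h]

/-- The colon ideal of the symmetric ideal by `a * yᵢ` consists of elements of the Rees ideal,
the latter being prime and not containing `a * yᵢ`. -/
theorem symIdeal_colon_le_reesIdeal [IsDomain R] {a : R} {i : Fin n} (h : a * g i ≠ 0) :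
    (symIdeal g).colon {C a * X i} ≤ reesIdeal g := fun F hF => by
  rw [Submodule.mem_colon_singleton, smul_eq_mul] at hF
  refine ((isPrime_reesIdeal g).mem_or_mem (symIdeal_le_reesIdeal g hF)).resolve_right ?_
  rwa [C_mul_X_mem_reesIdeal_iff]

end Rees

/-! ### Products of all forms but one -/

section Products

variable {R : Type*} [CommRing R] {n : ℕ}

/-- If `rⱼ gⱼ = p` for all `j`, then modulo the relations `rⱼ yⱼ = z` one has `p yⱼ = z gⱼ`, so
that `p ^ e * F` becomes `z ^ e` times the value of `F` at the `gⱼ`. -/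
theorem pow_prod_mul_mem_incidenceIdeal (r g : Fin n → R) (p : R) (hg : ∀ j, r j * g j = p)
    {F : MvPolynomial (Fin n) R} {e : ℕ} (hF : F.IsHomogeneous e) (h0 : aeval g F = 0) :
    C (Polynomial.C (p ^ e)) * map Polynomial.C F ∈
      incidenceIdeal (⊥ : Ideal (Polynomial R)) Polynomial.X (fun j => Polynomial.C (r j)) := by
  set J := incidenceIdeal (⊥ : Ideal (Polynomial R)) Polynomial.X (fun j => Polynomial.C (r j))
  let A := MvPolynomial (Fin n) (Polynomial R) ⧸ J
  let y : Fin n → A := fun j => Ideal.Quotient.mk J (X j)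
  let z : A := Ideal.Quotient.mk J (C Polynomial.X)
  have hmap : ∀ F : MvPolynomial (Fin n) R,
      Ideal.Quotient.mk J (map Polynomial.C F) = aeval y F := fun F => by
    rw [aeval_def]
    induction F using MvPolynomial.induction_on with
    | C a => simp; rfl
    | add f g hf hg => simp [hf, hg]
    | mul_X f i hf => simp [hf, y]
  have hy : ∀ j, algebraMap R A p * y j = z * algebraMap R A (g j) := fun j => by
    have h1 : algebraMap R A (r j) * y j = z := by
      have := Ideal.Quotient.eq.2 (mul_X_sub_mem_incidenceIdeal (⊥ : Ideal (Polynomial R))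
        Polynomial.X (fun j => Polynomial.C (r j)) j)
      rw [map_mul] at this
      exact this
    rw [← hg j, map_mul, ← h1]
    ring
  rw [← Ideal.Quotient.eq_zero_iff_mem, map_mul, hmap]
  change algebraMap R A (p ^ e) * aeval y F = 0
  rw [map_pow, ← aeval_mul_of_isHomogeneous hF]
  simp only [hy]
  rw [aeval_mul_of_isHomogeneous hF]
  have h1 : aeval (fun j => algebraMap R A (g j)) F = algebraMap R A (aeval g F) :=
    aeval_algebraMap_apply A g F
  rw [h1, h0, map_zero, mul_zero]

/-- Specialising `z` to `rᵢ yᵢ` sends the relations `rⱼ yⱼ = z` to first syzygies of the `gⱼ`. -/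
theorem mul_X_mul_mem_symIdeal (r g : Fin n → R) (p : R) (hg : ∀ j, r j * g j = p)
    (i : Fin n) {F : MvPolynomial (Fin n) R}
    (hF : C Polynomial.X * map Polynomial.C F ∈
      incidenceIdeal (⊥ : Ideal (Polynomial R)) Polynomial.X (fun j => Polynomial.C (r j))) :
    C (r i) * X i * F ∈ symIdeal g := by
  let θ : MvPolynomial (Fin n) (Polynomial R) →+* MvPolynomial (Fin n) R :=
    eval₂Hom (Polynomial.eval₂RingHom C (C (r i) * X i)) X
  have hle : incidenceIdeal (⊥ : Ideal (Polynomial R)) Polynomial.X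
      (fun j => Polynomial.C (r j)) ≤ (symIdeal g).comap θ := by
    rw [incidenceIdeal, Ideal.map_bot, bot_sup_eq, Ideal.span_le]
    rintro _ ⟨j, rfl⟩
    simpa [θ] using sub_mem_symIdeal g ((hg j).trans (hg i).symm)
  have hθ : θ (map Polynomial.C F) = F := by
    have : (Polynomial.eval₂RingHom C (C (r i) * X i)).comp Polynomial.C =
        (C : R →+* MvPolynomial (Fin n) R) := by ext1; simp
    simp only [θ, coe_eval₂Hom, eval₂_map, this, eval₂_eta]
  have := hle hF
  rw [Ideal.mem_comap, map_mul, hθ] at this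
  simpa [θ] using this

/-- If all subfamilies of the `rⱼ` generate prime ideals, then `rᵢ yᵢ` multiplies the Rees ideal
of the products of all `rⱼ` but one into the symmetric ideal. -/
theorem mul_mem_symIdeal_of_mem_reesIdeal [IsDomain R] (r g : Fin n → R) (p : R) (hp : p ≠ 0)
    (hg : ∀ j, r j * g j = p) (hr : ∀ S : Set (Fin n), (Ideal.span (r '' S)).IsPrime) (i : Fin n)
    {F : MvPolynomial (Fin n) R} (hF : F ∈ reesIdeal g) : C (r i) * X i * F ∈ symIdeal g := by
  have hprime : ∀ S : Set (Fin n), ((⊥ : Ideal (Polynomial R)) ⊔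
      Ideal.span ((fun j => Polynomial.C (r j)) '' S)).IsPrime := fun S => by
    have := hr S
    have h : Ideal.span ((fun j => Polynomial.C (r j)) '' S) =
        (Ideal.span (r '' S)).map Polynomial.C := by
      rw [Ideal.map_span, Set.image_image]
    rw [bot_sup_eq, h]
    exact Ideal.isPrime_map_C_iff_isPrime _ |>.2 this
  rw [← sum_homogeneousComponent F, Finset.mul_sum]
  refine sum_mem fun e _ => mul_X_mul_mem_symIdeal r g p hg i ?_
  have h := pow_prod_mul_mem_incidenceIdeal r g p hg (homogeneousComponent_isHomogeneous e F)
    (aeval_homogeneousComponent_eq_zero g hF e)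
  refine regularOnMultiples_incidenceIdeal ⊥ Polynomial.X _ hprime
    (q := Polynomial.C (p ^ e)) (by simpa using fun h => absurd h hp) _ ?_
  convert Ideal.mul_mem_left _ (C Polynomial.X) h using 1
  ring

end Products

end ReesArrangement

theorem mainTheorem6 {K : Type*} [Field K] {k n : ℕ}
    (ℓ : Fin n → MvPolynomial (Fin k) K) (hℓ : ReesArrangement.IsCentralArrangement ℓ)
    (i : Fin n) :
    ReesArrangement.reesIdeal (ReesArrangement.foldProd ℓ) =
      (ReesArrangement.symIdeal (ReesArrangement.foldProd ℓ)).colon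
        {MvPolynomial.C (ℓ i) * MvPolynomial.X i} := by
  have hg : ∀ j, ℓ j * ReesArrangement.foldProd ℓ j = ∏ j, ℓ j := fun j =>
    Finset.mul_prod_erase _ ℓ (Finset.mem_univ j)
  have hp : ∏ j, ℓ j ≠ 0 := Finset.prod_ne_zero_iff.2 fun j _ => hℓ.ne_zero j
  refine le_antisymm (fun F hF => ?_)
    (ReesArrangement.symIdeal_colon_le_reesIdeal _ (by rwa [hg i]))
  rw [Submodule.mem_colon_singleton, smul_eq_mul, mul_comm]
  refine ReesArrangement.mul_mem_symIdeal_of_mem_reesIdeal ℓ _ _ hp hg (fun S => ?_) i hF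
  refine ReesArrangement.isPrime_span_of_isHomogeneous_one _ ?_
  rintro _ ⟨j, _, rfl⟩
  exact hℓ.isLinearForm j
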